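/- **Setting.** Let $\mathcal A$ be an algebra of subsets of a set $\Omega$ and $m$ a finitely additive probability on $\mathcal A$. Put $m^*(E)=\inf\{m(A):A\in\mathcal A,\ E\subset A\}$. For a normed space $Y$, functions $g_n:\Omega\to Y$ $m$-converge to $g$ if $\lim_n m^*(\|g_n-g\|>c)=0$ for all $c>0$, and $g$ is $m$-null if $m^*(\|g\|>c)=0$ for all $c>0$. Write $g\in L^0_Y(m)$ if $g$ is the $m$-limit of $\mathcal A$-simple functions $g_n$, and $g\in L^1_Y(m)$ if these may be chosen with $\lim_{n,k}\int\|g_n-g_k\|\,dm=0$; for $Y=\mathbb R$, $\int_A g\,dm=\lim_n\int_A g_n\,dm$ for $A\in\mathcal A$. Let $\mathcal A(m)$ be the family of all $E\subset\Omega$ such that for each $\varepsilon>0$ there are $A,B\in\mathcal A$ with $A\subset E\subset B$ and $m(B\setminus A)<\varepsilon$. Let $X$ be a real Banach space and $f:\Omega\to X$ weakly measurable ($x^*f\in L^0(m)$ for all $x^*\in X^*$). $f$ is norm integrable if $\|f\|\in L^1(m)$. Let $\mathcal L(m,f)$ be the set of all $H:\Omega\times X\to\mathbb R$ such that $H(f):=H(\cdot,f(\cdot))\in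 L^1(m)$, with $\|H\|=\int|H(f)|\,dm$, and $\mathcal L_b(m,f)$ the set of its bounded elements; functions $h$ on $X$ are identified with the functions $(\omega,x)\mapsto h(x)$. An *abstract standard representation* of $(m,f)$ is a triple $(\chi,\lambda,T)$ where $\lambda$ is a regular Borel probability on a compact Hausdorff space $S$, $\chi$ is a Boolean homomorphism of $\mathcal A(m)$ into the clopen subsets of $S$, and $T:\mathcal L(m,f)\to L^1(\lambda)$ is an isometric vector lattice homomorphism with $\int_A H(f)\,dm=\int_{\chi(A)}T(H)\,d\lambda$ for $A\in\mathcal A$, $H\in\mathcal L(m,f)$, such that: (a) $T$ restricts to an algebraic isomorphism of $\mathcal L_b(m,f)$ onto $C(S)$ (that is, there is such an isomorphism $U$ for which $U(H)$ is a representative of $T(H)$, $H\in\mathcal L_b(m,f)$); (b) each element of $C(S)$ is measurable for the $\sigma$-algebra generated by the clopen sets; (c) for each clopen $E\subset S$ there is $A\in\mathcal A(m)$ with $\lambda(E\bigtriangleup\chi(A))=0$; (d) $T[\mathcal L(m,f)]$ is norm dense in $L^1(\lambda)$; (e) $\alpha(T(H_1),\dots,T(H_n))=T(\alpha(H_1,\dots,H_n))$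 $\lambda$-a.s. for all $n$, $H_1,\dots,H_n\in\mathcal L(m,f)$ and bounded continuous $\alpha:\mathbb R^n\to\mathbb R$; (f) for $A\in\mathcal A(m)$ and $H\in\mathcal L(m,f)$, $H(f)$ is $m$-null on $A$ if and only if $T(H)=0$ $\lambda$-a.s. on $\chi(A)$; moreover $\lambda\big(\chi(A)\setminus\bigcap\{U(H)=0\}\big)=0$, the intersection being over all $H\in\mathcal L_b(m,f)$ with $H(f)$ $m$-null on $A$. **Theorem 7.1.** Let $X$ be a separable real Banach space and let $f$ be weakly measurable and norm integrable, with abstract standard representation $(\chi,\lambda,T)$. There exist $\eta\in L^1(\lambda)$, $\eta\ge0$, and $\tilde f\in L^1_X(\lambda)$ with $\tilde f=0$ on $\{\eta>0\}$, such that, writing $$T(h)=h(\tilde f)+T^\perp(h)\quad \lambda\text{-a.s.},\qquad h:X\to\mathbb R,\ h\in\mathcal L(m,f),$$ the remainder $T^\perp$ has the following properties, for every choice of pointwise representatives $s\mapsto T^\perp(h)(s)$ and every $x^*\in X^*$: (1) $T^\perp(x^*)=0$ $\lambda$-a.s. on $\{\eta=0\}$ (that is, $T(x^*)=x^*\tilde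 f$ there); (2) for $\lambda$-almost every $s\in S$, in $[-\infty,+\infty]$, $$T^\perp(x^*)(s)\ \ge\ \eta(s)+\inf_{\sigma}\ \limsup_n\,T^\perp(\sigma_n)(s),$$ where the infimum is taken, for each $s$, over all bounded sequences $\sigma=(\sigma_n)$ in $X^*$ that converge weakly$^*$ to $x^*$. -/

import Mathlib

open MeasureTheory Set Filter Topology
open scoped NNReal

namespace FinAdd

noncomputable section

/-! Finitely additive integration: `m : AddContent ℝ≥0 𝒜` is a finitely additive set function on
an algebra `𝒜` of subsets of `Ω` (its values off `𝒜` are never used). -/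

section Integration

variable {Ω : Type*} {𝒜 : Set (Set Ω)} {Y : Type*} [NormedAddCommGroup Y]

/-- The outer measure `m^*(E) = inf {m(A) : A ∈ 𝒜, E ⊆ A}`. -/
def outer (m : AddContent ℝ≥0 𝒜) (E : Set Ω) : ℝ≥0 :=
  sInf {r | ∃ A ∈ 𝒜, E ⊆ A ∧ m A = r}

/-- The completion `𝒜(m)`: the sets squeezed between members of `𝒜` whose difference has
arbitrarily small `m`-value. -/
def completion (m : AddContent ℝ≥0 𝒜) : Set (Set Ω) :=
  {E | ∀ ε : ℝ≥0, 0 < ε → ∃ A ∈ 𝒜, ∃ B ∈ 𝒜, A ⊆ E ∧ E ⊆ B ∧ m (B \ A) < ε}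

/-- `𝒜`-simple functions. -/
def IsSimple (𝒜 : Set (Set Ω)) (g : Ω → Y) : Prop :=
  (range g).Finite ∧ ∀ y, g ⁻¹' {y} ∈ 𝒜

/-- `g n` converges to `g₀` in `m`-measure. -/
def ConvInMeasure (m : AddContent ℝ≥0 𝒜) (g : ℕ → Ω → Y) (g₀ : Ω → Y) : Prop :=
  ∀ c : ℝ, 0 < c → Tendsto (fun n => outer m {ω | c < ‖g n ω - g₀ ω‖}) atTop (𝓝 0)

/-- `g` is `m`-null. -/
def IsNull (m : AddContent ℝ≥0 𝒜) (g : Ω → Y) : Prop :=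
  ∀ c : ℝ, 0 < c → outer m {ω | c < ‖g ω‖} = 0

/-- `g ∈ L⁰_Y(m)`: `g` is the limit in `m`-measure of a sequence of `𝒜`-simple functions. -/
def MemL0 (m : AddContent ℝ≥0 𝒜) (g : Ω → Y) : Prop :=
  ∃ s : ℕ → Ω → Y, (∀ n, IsSimple 𝒜 (s n)) ∧ ConvInMeasure m s g

/-- The integral over `A ∈ 𝒜` of a real valued `𝒜`-simple function. -/
def simpleIntegral (m : AddContent ℝ≥0 𝒜) (A : Set Ω) (g : Ω → ℝ) : ℝ :=
  ∑ᶠ y : ℝ, (m (A ∩ g ⁻¹' {y}) : ℝ) * y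

/-- `s` is a determining sequence for `g`: simple functions that converge to `g` in `m`-measure
and satisfy `lim_{n,k} ∫ ‖s n - s k‖ dm = 0`. -/
def IsDetermining (m : AddContent ℝ≥0 𝒜) (s : ℕ → Ω → Y) (g : Ω → Y) : Prop :=
  (∀ n, IsSimple 𝒜 (s n)) ∧ ConvInMeasure m s g ∧
    Tendsto (fun p : ℕ × ℕ => simpleIntegral m univ (fun ω => ‖s p.1 ω - s p.2 ω‖)) atTop (𝓝 0)

/-- `g ∈ L¹_Y(m)`. -/
def MemL1 (m : AddContent ℝ≥0 𝒜) (g : Ω → Y) : Prop :=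
  ∃ s : ℕ → Ω → Y, IsDetermining m s g

/-- `∫_A g dm = I`, for `A ∈ 𝒜`: `g` is integrable and `I` is the limit of the integrals over `A`
of a determining sequence. -/
def HasIntegral (m : AddContent ℝ≥0 𝒜) (A : Set Ω) (g : Ω → ℝ) (I : ℝ) : Prop :=
  ∃ s : ℕ → Ω → ℝ, IsDetermining m s g ∧ Tendsto (fun n => simpleIntegral m A (s n)) atTop (𝓝 I)

end Integration

section Representation

variable {Ω : Type*} {𝒜 : Set (Set Ω)} {X : Type*} [NormedAddCommGroup X] [NormedSpace ℝ X]

/-- `f` is weakly measurable: `x^* f ∈ L⁰(m)` for all `x^* ∈ X^*`. -/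
def WeaklyMeasurable (m : AddContent ℝ≥0 𝒜) (f : Ω → X) : Prop :=
  ∀ x' : StrongDual ℝ X, MemL0 m (fun ω => x' (f ω))

/-- `f` is norm integrable: `‖f‖ ∈ L¹(m)`. -/
def NormIntegrable (m : AddContent ℝ≥0 𝒜) (f : Ω → X) : Prop :=
  MemL1 m (fun ω => ‖f ω‖)

/-- The space `𝓛(m, f)` of all `H : Ω × X → ℝ` with `H(·, f(·)) ∈ L¹(m)`. -/
def Lspace (m : AddContent ℝ≥0 𝒜) (f : Ω → X) : Set (Ω × X → ℝ) :=
  {H | MemL1 m (fun ω => H (ω, f ω))}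

/-- The bounded elements of `𝓛(m, f)`. -/
def LspaceB (m : AddContent ℝ≥0 𝒜) (f : Ω → X) : Set (Ω × X → ℝ) :=
  {H | H ∈ Lspace m f ∧ ∃ C : ℝ, ∀ p, |H p| ≤ C}

/-- A function on `X`, seen as a function on `Ω × X`. -/
def lift (Ω : Type*) (h : X → ℝ) : Ω × X → ℝ := fun p => h p.2

/-- `(χ, lam, T)` is an abstract standard representation of `(m, f)`. The map `T` takes `𝓛(m, f)`
to `L¹(lam)` and `χ` takes `𝒜(m)` to the clopen subsets of `S`; both are written as total functions
and their values elsewhere are unrestricted. -/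
structure IsAbstractStandardRepresentation (m : AddContent ℝ≥0 𝒜) (f : Ω → X)
    {S : Type*} [TopologicalSpace S] [MeasurableSpace S]
    (χ : Set Ω → Set S) (lam : Measure S) (T : (Ω × X → ℝ) → Lp ℝ 1 lam) : Prop where
  -- `lam` is a regular probability, on the Borel sets of a compact Hausdorff space
  compact : CompactSpace S
  hausdorff : T2Space S
  borel : BorelSpace S
  prob : IsProbabilityMeasure lam
  regular : lam.Regular
  -- `χ` is a Boolean homomorphism of `𝒜(m)` into the clopen sets
  chi_clopen : ∀ A ∈ completion m, IsClopen (χ A)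
  chi_empty : χ ∅ = ∅
  chi_univ : χ univ = univ
  chi_compl : ∀ A ∈ completion m, χ Aᶜ = (χ A)ᶜ
  chi_union : ∀ A ∈ completion m, ∀ B ∈ completion m, χ (A ∪ B) = χ A ∪ χ B
  -- `T` is an isometric homomorphism of vector lattices
  T_add : ∀ H ∈ Lspace m f, ∀ K ∈ Lspace m f, T (H + K) = T H + T K
  T_smul : ∀ c : ℝ, ∀ H ∈ Lspace m f, T (c • H) = c • T H
  T_sup : ∀ H ∈ Lspace m f, ∀ K ∈ Lspace m f, T (H ⊔ K) = T H ⊔ T K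
  T_inf : ∀ H ∈ Lspace m f, ∀ K ∈ Lspace m f, T (H ⊓ K) = T H ⊓ T K
  T_isometric : ∀ H ∈ Lspace m f, HasIntegral m univ (fun ω => |H (ω, f ω)|) ‖T H‖
  -- `∫_A H(f) dm = ∫_{χ(A)} T(H) dlam`
  T_integral : ∀ A ∈ 𝒜, ∀ H ∈ Lspace m f,
    HasIntegral m A (fun ω => H (ω, f ω)) (∫ s in χ A, T H s ∂lam)
  -- `T` is an algebraic isomorphism `U` of the bounded elements of `𝓛(m, f)` onto `C(S)`;
  -- moreover `χ(A)` is, up to a null set, contained in the zero set of the (continuous) image of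
  -- all bounded `H` such that `H(f)` is null on `A`
  bounded_iso : ∃ U : (Ω × X → ℝ) → C(S, ℝ),
    BijOn U (LspaceB m f) univ ∧
    (∀ H ∈ LspaceB m f, ∀ K ∈ LspaceB m f, U (H + K) = U H + U K) ∧
    (∀ c : ℝ, ∀ H ∈ LspaceB m f, U (c • H) = c • U H) ∧
    (∀ H ∈ LspaceB m f, ∀ K ∈ LspaceB m f, U (H * K) = U H * U K) ∧
    (∀ H ∈ LspaceB m f, T H =ᵐ[lam] U H) ∧
    ∀ A ∈ completion m,
      lam (χ A \ ⋂ H ∈ {H | H ∈ LspaceB m f ∧ IsNull m (A.indicator fun ω => H (ω, f ω))},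
        {s | U H s = 0}) = 0
  -- continuous functions are measurable for the `σ`-algebra generated by the clopen sets
  continuous_meas : ∀ g : C(S, ℝ), ∀ B : Set ℝ, MeasurableSet B →
    MeasurableSet[MeasurableSpace.generateFrom {E : Set S | IsClopen E}] (g ⁻¹' B)
  clopen_ae : ∀ E : Set S, IsClopen E → ∃ A ∈ completion m, lam (symmDiff E (χ A)) = 0
  dense_range : closure (T '' Lspace m f) = univ
  T_comp : ∀ (n : ℕ) (H : Fin n → Ω × X → ℝ), (∀ i, H i ∈ Lspace m f) →
    ∀ α : (Fin n → ℝ) → ℝ, Continuous α → (∃ C : ℝ, ∀ v, |α v| ≤ C) →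
      T (fun p => α fun i => H i p) =ᵐ[lam] fun s => α fun i => T (H i) s
  null_iff : ∀ A ∈ completion m, ∀ H ∈ Lspace m f,
    (IsNull m (A.indicator fun ω => H (ω, f ω)) ↔ ∀ᵐ s ∂lam, s ∈ χ A → T H s = 0)

/-- `P` is (a choice of representatives of) the remainder `T^⊥` of `T` with respect to `f'`:
`T(h) = h(f') + T^⊥(h)` almost everywhere, for every function `h` on `X` in `𝓛(m, f)`. -/
def IsRemainder (m : AddContent ℝ≥0 𝒜) (f : Ω → X) {S : Type*} [MeasurableSpace S]
    {lam : Measure S} (T : (Ω × X → ℝ) → Lp ℝ 1 lam) (f' : S → X)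
    (P : (X → ℝ) → S → ℝ) : Prop :=
  ∀ h : X → ℝ, lift Ω h ∈ Lspace m f → T (lift Ω h) =ᵐ[lam] fun s => h (f' s) + P h s

/-- `Σ(x^*)`: the bounded sequences in `X^*` that converge weakly* to `x^*`. -/
def weakStarSeq (x' : StrongDual ℝ X) : Set (ℕ → StrongDual ℝ X) :=
  {σ | (∃ C : ℝ, ∀ n, ‖σ n‖ ≤ C) ∧
    Tendsto (fun n => StrongDual.toWeakDual (σ n)) atTop (𝓝 (StrongDual.toWeakDual x'))}

end Representation

end

end FinAdd

/-! Write `φ d = T(d)` for `d` in the dual of `X`. This family is a.e. linear in `d` and dominated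
by `‖d‖ * N`, where `N = T(‖·‖)` is integrable. For fixed `s` the question is whether `d ↦ φ d s` is
evaluation at a point of `X`, that is, whether it is weak* continuous on the unit ball. The obstacle
is that each relation holds off its own null set while the dual may be uncountable.

For a countable set `D` of functionals, `oscAt` measures at each `s` how far `φ` drops along weak*
null members of the unit ball of `D`. It grows with `D`, so some `D` maximizes its integral
(`exists_maximal_oscAt`); enlarge it to a countable norming `ℚ`-subspace and let `η` be its
oscillation. Where `η = 0`, a Hahn–Banach argument and completeness (`exists_eq_eval`) represent `φ`
on `D` by a point `g s`. For any further `d`, maximality says that adjoining `d` leaves the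
oscillation a.e. unchanged, so the same point also represents `φ d`. Where `η > 0`, set `g = 0`; the
oscillation supplies a weak* null sequence in `D` along which `φ` is at most `-η + o(1)`.
Translating it by `x'` gives the inequality, and since `D` is countable one null set suffices. -/

namespace FinAdd

/-! ### Simple functions and dominated integrability for finitely additive `m`. -/

section Simple

variable {Ω : Type*} {𝒜 : Set (Set Ω)} {Y Z : Type*}

theorem IsSimple.preimage_mem (h𝒜 : IsSetAlgebra 𝒜) {p : Ω → Y} (hp : IsSimple 𝒜 p) (s : Set Y) :
    p ⁻¹' s ∈ 𝒜 := by
  classical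
  have : p ⁻¹' s = ⋃ i ∈ hp.1.toFinset.filter (· ∈ s), p ⁻¹' {i} := by
    ext ω
    simp
  rw [this]
  exact h𝒜.biUnion_mem _ fun i _ => hp.2 i

theorem IsSimple.comp (h𝒜 : IsSetAlgebra 𝒜) {p : Ω → Y} (hp : IsSimple 𝒜 p) (φ : Y → Z) :
    IsSimple 𝒜 (fun ω => φ (p ω)) := by
  refine ⟨?_, fun y => hp.preimage_mem h𝒜 (φ ⁻¹' {y})⟩
  have := hp.1.image φ
  rwa [← range_comp] at this

theorem IsSimple.prodMk (h𝒜 : IsSetAlgebra 𝒜) {p : Ω → Y} {q : Ω → Z} (hp : IsSimple 𝒜 p)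
    (hq : IsSimple 𝒜 q) : IsSimple 𝒜 (fun ω => (p ω, q ω)) := by
  refine ⟨(hp.1.prod hq.1).subset ?_, ?_⟩
  · rintro _ ⟨ω, rfl⟩
    exact ⟨mem_range_self _, mem_range_self _⟩
  · rintro ⟨y, z⟩
    convert h𝒜.inter_mem (hp.2 y) (hq.2 z) using 1
    ext ω
    simp

theorem isSimple_const (h𝒜 : IsSetAlgebra 𝒜) (y : Y) : IsSimple 𝒜 (fun _ : Ω => y) := by
  refine ⟨(finite_singleton y).subset (by rintro _ ⟨ω, rfl⟩; rfl), fun z => ?_⟩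
  by_cases h : y = z
  · simpa [preimage_const, h] using h𝒜.univ_mem
  · simpa [preimage_const, h] using h𝒜.empty_mem

variable {m : AddContent ℝ≥0 𝒜}

/-- Refining the level sets of the composite to those of `p` lets several simple functions be
integrated over one common partition; order and additivity follow by taking `p` to be a pair. -/
theorem simpleIntegral_comp (h𝒜 : IsSetAlgebra 𝒜) {p : Ω → Y} (hp : IsSimple 𝒜 p) (φ : Y → ℝ) :
    simpleIntegral m univ (fun ω => φ (p ω)) =
      ∑ i ∈ hp.1.toFinset, (m (p ⁻¹' {i}) : ℝ) * φ i := by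
  classical
  have key : ∀ y : ℝ, (m (univ ∩ (fun ω => φ (p ω)) ⁻¹' {y}) : ℝ) * y =
      ∑ i ∈ hp.1.toFinset.filter (fun i => φ i = y), (m (p ⁻¹' {i}) : ℝ) * φ i := by
    intro y
    have h1 : univ ∩ (fun ω => φ (p ω)) ⁻¹' {y} =
        ⋃ i ∈ hp.1.toFinset.filter (fun i => φ i = y), p ⁻¹' {i} := by
      ext ω
      simp
    rw [h1, addContent_biUnion_eq h𝒜.isSetRing (fun i _ => hp.2 i)
      (fun i _ j _ hij => Disjoint.preimage p (by simpa using hij)), NNReal.coe_sum,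
      Finset.sum_mul]
    refine Finset.sum_congr rfl fun i hi => ?_
    rw [(Finset.mem_filter.1 hi).2]
  rw [simpleIntegral, finsum_eq_sum_of_support_subset (s := hp.1.toFinset.image φ)]
  · rw [Finset.sum_congr rfl fun y _ => key y]
    exact Finset.sum_fiberwise_of_maps_to (fun i hi => Finset.mem_image_of_mem φ hi) _
  · intro y hy
    rw [Function.mem_support, key] at hy
    obtain ⟨i, hi, -⟩ := Finset.exists_ne_zero_of_sum_ne_zero hy
    obtain ⟨hi', rfl⟩ := Finset.mem_filter.1 hi
    exact Finset.mem_image_of_mem φ hi'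

theorem simpleIntegral_mono (h𝒜 : IsSetAlgebra 𝒜) {u v : Ω → ℝ} (hu : IsSimple 𝒜 u)
    (hv : IsSimple 𝒜 v) (huv : ∀ ω, u ω ≤ v ω) :
    simpleIntegral m univ u ≤ simpleIntegral m univ v := by
  have hp := hu.prodMk h𝒜 hv
  rw [show simpleIntegral m univ u = _ from simpleIntegral_comp h𝒜 hp Prod.fst,
    show simpleIntegral m univ v = _ from simpleIntegral_comp h𝒜 hp Prod.snd]
  refine Finset.sum_le_sum fun i hi => mul_le_mul_of_nonneg_left ?_ (NNReal.coe_nonneg _)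
  obtain ⟨ω, rfl⟩ := hp.1.mem_toFinset.1 hi
  exact huv ω

theorem simpleIntegral_add (h𝒜 : IsSetAlgebra 𝒜) {u v : Ω → ℝ} (hu : IsSimple 𝒜 u)
    (hv : IsSimple 𝒜 v) :
    simpleIntegral m univ (fun ω => u ω + v ω) =
      simpleIntegral m univ u + simpleIntegral m univ v := by
  have hp := hu.prodMk h𝒜 hv
  rw [show simpleIntegral m univ u = _ from simpleIntegral_comp h𝒜 hp Prod.fst,
    show simpleIntegral m univ v = _ from simpleIntegral_comp h𝒜 hp Prod.snd,
    simpleIntegral_comp h𝒜 hp (fun q => q.1 + q.2), ← Finset.sum_add_distrib]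
  exact Finset.sum_congr rfl fun i _ => mul_add _ _ _

theorem simpleIntegral_const_mul (h𝒜 : IsSetAlgebra 𝒜) {u : Ω → ℝ} (hu : IsSimple 𝒜 u) (c : ℝ) :
    simpleIntegral m univ (fun ω => c * u ω) = c * simpleIntegral m univ u := by
  rw [show simpleIntegral m univ u = _ from simpleIntegral_comp h𝒜 hu id,
    simpleIntegral_comp h𝒜 hu (fun q => c * q), Finset.mul_sum]
  exact Finset.sum_congr rfl fun i _ => mul_left_comm _ _ _

theorem simpleIntegral_const (c : ℝ) :
    simpleIntegral m univ (fun _ => c) = m univ * c := by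
  rw [simpleIntegral, finsum_eq_single _ c]
  · simp
  · intro y hy
    simp [hy.symm]

theorem simpleIntegral_indicator_one (A : Set Ω) :
    simpleIntegral m univ (A.indicator fun _ => (1 : ℝ)) = m A := by
  classical
  rw [simpleIntegral, finsum_eq_single _ 1]
  · simp [indicator_const_preimage_eq_union]
  · intro y hy
    by_cases h0 : y = 0
    · simp [h0]
    · have : (A.indicator fun _ => (1 : ℝ)) ⁻¹' {y} = ∅ := by
        ext ω
        by_cases hω : ω ∈ A <;> simp [hω, hy.symm, Ne.symm h0]
      simp [this]

theorem isSimple_indicator (h𝒜 : IsSetAlgebra 𝒜) {A : Set Ω} (hA : A ∈ 𝒜) :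
    IsSimple 𝒜 (A.indicator fun _ => (1 : ℝ)) := by
  classical
  refine ⟨(toFinite {(0 : ℝ), 1}).subset ?_, fun y => ?_⟩
  · rintro _ ⟨ω, rfl⟩
    by_cases h : ω ∈ A <;> simp [h]
  · have : (A.indicator fun _ => (1 : ℝ)) ⁻¹' {y} =
        (if (1 : ℝ) = y then A else ∅) ∪ (if (0 : ℝ) = y then Aᶜ else ∅) := by
      ext ω
      by_cases h : ω ∈ A <;> split_ifs <;> simp_all
    rw [this]
    refine h𝒜.union_mem ?_ ?_ <;> split_ifs
    exacts [hA, h𝒜.empty_mem, h𝒜.compl_mem hA, h𝒜.empty_mem]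

theorem outer_mono (h𝒜 : IsSetAlgebra 𝒜) {E F : Set Ω} (h : E ⊆ F) : outer m E ≤ outer m F := by
  refine csInf_le_csInf (OrderBot.bddBelow _) ⟨_, univ, h𝒜.univ_mem, subset_univ _, rfl⟩ ?_
  rintro _ ⟨A, hA, hFA, rfl⟩
  exact ⟨A, hA, h.trans hFA, rfl⟩

theorem outer_union_le (h𝒜 : IsSetAlgebra 𝒜) (E F : Set Ω) :
    outer m (E ∪ F) ≤ outer m E + outer m F := by
  refine le_of_forall_pos_le_add fun ε hε => ?_
  have key : ∀ G : Set Ω, ∃ A ∈ 𝒜, G ⊆ A ∧ m A < outer m G + ε / 2 := by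
    intro G
    obtain ⟨_, ⟨A, hA, hGA, rfl⟩, hlt⟩ := exists_lt_of_csInf_lt
      (⟨_, univ, h𝒜.univ_mem, subset_univ _, rfl⟩ :
        {r | ∃ A ∈ 𝒜, G ⊆ A ∧ m A = r}.Nonempty)
      (lt_add_of_pos_right (outer m G) (half_pos hε))
    exact ⟨A, hA, hGA, hlt⟩
  obtain ⟨A, hA, hEA, h1⟩ := key E
  obtain ⟨B, hB, hFB, h2⟩ := key F
  calc outer m (E ∪ F) ≤ m (A ∪ B) :=
        csInf_le (OrderBot.bddBelow _) ⟨_, h𝒜.union_mem hA hB, union_subset_union hEA hFB, rfl⟩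
    _ ≤ m A + m B := addContent_union_le h𝒜.isSetRing hA hB
    _ ≤ (outer m E + ε / 2) + (outer m F + ε / 2) := add_le_add h1.le h2.le
    _ = outer m E + outer m F + ε := by rw [add_add_add_comm, add_halves]

theorem le_outer (h𝒜 : IsSetAlgebra 𝒜) {A : Set Ω} (hA : A ∈ 𝒜) : m A ≤ outer m A := by
  refine le_csInf ⟨_, univ, h𝒜.univ_mem, subset_univ _, rfl⟩ ?_
  rintro _ ⟨B, hB, hAB, rfl⟩
  exact addContent_mono h𝒜.isSetRing.isSetSemiring hA hB hAB

/-- The value `a` clamped to the interval `[-c |b|, c |b|]`. -/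
def clamp (c a b : ℝ) : ℝ := max (-(c * |b|)) (min a (c * |b|))

theorem clamp_of_abs_le {c a b : ℝ} (h : |a| ≤ c * |b|) : clamp c a b = a := by
  rw [clamp, min_eq_left (abs_le.1 h).2, max_eq_right (abs_le.1 h).1]

theorem abs_clamp_le {c : ℝ} (hc : 0 ≤ c) (a b : ℝ) : |clamp c a b| ≤ c * |b| := by
  have : 0 ≤ c * |b| := by positivity
  exact abs_le.2 ⟨le_max_left _ _, max_le (by linarith) (min_le_right _ _)⟩

theorem abs_clamp_sub_le {c : ℝ} (hc : 0 ≤ c) (a b a' b' : ℝ) :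
    |clamp c a b - clamp c a' b'| ≤ max |a - a'| (c * |b - b'|) := by
  have h1 : |(c * |b|) - (c * |b'|)| ≤ c * |b - b'| := by
    rw [← mul_sub, abs_mul, abs_of_nonneg hc]
    exact mul_le_mul_of_nonneg_left (abs_abs_sub_abs_le _ _) hc
  refine (abs_max_sub_max_le_max _ _ _ _).trans (max_le ?_ ((abs_min_sub_min_le_max _ _ _ _).trans
    (max_le_max le_rfl h1)))
  rw [neg_sub_neg, abs_sub_comm]
  exact h1.trans (le_max_right _ _)

/-- Clamping is 1-Lipschitz in its first real argument and `c`-Lipschitz in the second, so an error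
above `δ` forces an error in one of the two sequences. -/
theorem ConvInMeasure.clamp (h𝒜 : IsSetAlgebra 𝒜) {u v : ℕ → Ω → ℝ} {g h : Ω → ℝ} {c : ℝ}
    (hc : 0 ≤ c) (hu : ConvInMeasure m u g) (hv : ConvInMeasure m v h) :
    ConvInMeasure m (fun n ω => clamp c (u n ω) (v n ω)) (fun ω => FinAdd.clamp c (g ω) (h ω)) := by
  intro δ hδ
  have hδ' : 0 < δ / (c + 1) := by positivity
  have hlim := (hu δ hδ).add (hv _ hδ')
  rw [add_zero] at hlim
  refine tendsto_of_tendsto_of_tendsto_of_le_of_le tendsto_const_nhds hlim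
    (fun _ => zero_le) fun n => ?_
  refine (outer_mono h𝒜 ?_).trans (outer_union_le h𝒜 _ _)
  intro ω hω
  simp only [Real.norm_eq_abs, mem_ofPred_eq, mem_union] at hω ⊢
  rcases lt_max_iff.1 (hω.trans_le (abs_clamp_sub_le hc _ _ _ _)) with h1 | h1
  · exact Or.inl h1
  · right
    rw [div_lt_iff₀ (by positivity)]
    nlinarith [abs_nonneg (v n ω - h ω)]

/-- Clamping simple approximations of `g` by those of `h` does not spoil the limit, and transfers
the uniform integrability of the latter to them. This is what makes every functional of `f`
integrable. -/
theorem MemL0.memL1_of_abs_le (h𝒜 : IsSetAlgebra 𝒜) {g h : Ω → ℝ} {c : ℝ} (hc : 0 ≤ c)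
    (hg : MemL0 m g) (hh : MemL1 m h) (hgh : ∀ ω, |g ω| ≤ c * |h ω|) : MemL1 m g := by
  obtain ⟨u, hu, hug⟩ := hg
  obtain ⟨v, hv, hvh, hcau⟩ := hh
  set s : ℕ → Ω → ℝ := fun n ω => clamp c (u n ω) (v n ω) with hs
  have hsimple : ∀ n, IsSimple 𝒜 (s n) := fun n =>
    ((hu n).prodMk h𝒜 (hv n)).comp h𝒜 (fun q => clamp c q.1 q.2)
  have hconv : ConvInMeasure m s g := by
    have := hug.clamp h𝒜 hc hvh
    simpa only [clamp_of_abs_le (hgh _)] using this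
  refine ⟨s, hsimple, hconv, ?_⟩
  have hdiff : ∀ (w : ℕ → Ω → ℝ), (∀ n, IsSimple 𝒜 (w n)) → ∀ n k,
      IsSimple 𝒜 (fun ω => ‖w n ω - w k ω‖) := fun w hw n k =>
    ((hw n).prodMk h𝒜 (hw k)).comp h𝒜 (fun q => ‖q.1 - q.2‖)
  have hnonneg : ∀ (w : ℕ → Ω → ℝ), (∀ n, IsSimple 𝒜 (w n)) → ∀ n k,
      0 ≤ simpleIntegral m univ (fun ω => ‖w n ω - w k ω‖) := fun w hw n k => by
    have := simpleIntegral_mono (m := m) h𝒜 (isSimple_const h𝒜 0) (hdiff w hw n k)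
      (fun ω => norm_nonneg _)
    rwa [simpleIntegral_const, mul_zero] at this
  rw [Metric.tendsto_atTop]
  intro ε hε
  -- the determining sequence of `h` is Cauchy
  obtain ⟨⟨a, b⟩, hab⟩ := (Metric.tendsto_atTop.1 hcau) (ε / (4 * (c + 1))) (by positivity)
  obtain ⟨n₀, hn₀⟩ : ∃ n₀, ∀ n ≥ n₀, c * simpleIntegral m univ (fun ω => ‖v n ω - v n₀ ω‖)
      ≤ ε / 4 := by
    refine ⟨max a b, fun n hn => ?_⟩
    have := hab (n, max a b) ⟨(le_max_left _ _).trans hn, le_max_right _ _⟩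
    rw [Real.dist_0_eq_abs, abs_of_nonneg (hnonneg v hv _ _), lt_div_iff₀ (by positivity)] at this
    nlinarith [hnonneg v hv n (max a b)]
  obtain ⟨M, hM⟩ : ∃ M, ∀ ω, |v n₀ ω| ≤ M := by
    obtain ⟨M, hM⟩ := ((hv n₀).1.image (fun x : ℝ => |x|)).bddAbove
    exact ⟨M, fun ω => hM ⟨_, mem_range_self ω, rfl⟩⟩
  have hM0 : 0 ≤ |M| := abs_nonneg M
  -- Error budget: `ε / 8` off the bad set `A`, `ε / 8` from the bounded function `v n₀` on `A`, and
  -- `ε / 4` for each of the two tails, in total `3ε / 4`.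
  set δ : ℝ := ε / (8 * (m univ + 1)) with hδdef
  have hδ : 0 < δ := by positivity
  have hmδ : m univ * δ ≤ ε / 8 := by
    rw [hδdef, mul_div_assoc', div_le_div_iff₀ (by positivity) (by positivity)]
    nlinarith [NNReal.coe_nonneg (m univ)]
  set κ : ℝ := ε / (16 * (2 * c * |M| + 1)) with hκdef
  have hκ : 0 < κ := by positivity
  have hκ' : 2 * c * |M| * (2 * κ) ≤ ε / 8 := by
    rw [hκdef, mul_div_assoc', mul_div_assoc', div_le_div_iff₀ (by positivity) (by positivity)]
    have : 0 ≤ c * |M| := by positivity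
    nlinarith
  obtain ⟨n₁, hn₁⟩ := (Metric.tendsto_atTop.1 (hconv (δ / 2) (half_pos hδ))) κ hκ
  have hn₁' : ∀ n ≥ n₁, (outer m {ω | δ / 2 < ‖s n ω - g ω‖} : ℝ) ≤ κ := by
    intro n hn
    have := (hn₁ n hn).le
    rwa [NNReal.dist_eq, NNReal.coe_zero, sub_zero, NNReal.abs_eq] at this
  refine ⟨(max n₀ n₁, max n₀ n₁), ?_⟩
  rintro ⟨n, k⟩ ⟨hn, hk⟩
  simp only at hn hk
  rw [Real.dist_0_eq_abs, abs_of_nonneg (hnonneg s hsimple _ _)]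
  set A : Set Ω := {ω | δ < ‖s n ω - s k ω‖} with hA
  have hA𝒜 : A ∈ 𝒜 := (hdiff s hsimple n k).preimage_mem h𝒜 (Ioi δ)
  have hmA : (m A : ℝ) ≤ 2 * κ := by
    have h1 : outer m A ≤ outer m {ω | δ / 2 < ‖s n ω - g ω‖} +
        outer m {ω | δ / 2 < ‖s k ω - g ω‖} := by
      refine (outer_mono h𝒜 ?_).trans (outer_union_le h𝒜 _ _)
      intro ω hω
      simp only [hA, mem_ofPred_eq, mem_union] at hω ⊢
      by_contra! hcon
      have := norm_sub_le_norm_sub_add_norm_sub (s n ω) (g ω) (s k ω)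
      rw [norm_sub_rev (g ω)] at this
      linarith
    have h2 : (m A : ℝ) ≤ _ := NNReal.coe_le_coe.2 ((le_outer h𝒜 hA𝒜).trans h1)
    rw [NNReal.coe_add] at h2
    linarith [hn₁' n ((le_max_right _ _).trans hn), hn₁' k ((le_max_right _ _).trans hk)]
  have hAs := isSimple_indicator h𝒜 hA𝒜
  have hq : ∀ j, IsSimple 𝒜 (fun ω => c * ‖v j ω - v n₀ ω‖) := fun j =>
    (hdiff v hv j n₀).comp h𝒜 (fun q => c * q)
  have hA2 : IsSimple 𝒜 (fun ω => 2 * c * |M| * A.indicator (fun _ => (1 : ℝ)) ω) :=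
    hAs.comp h𝒜 (fun q => 2 * c * |M| * q)
  have hl : IsSimple 𝒜 (fun ω => δ + 2 * c * |M| * A.indicator (fun _ => (1 : ℝ)) ω) :=
    hAs.comp h𝒜 (fun q => δ + 2 * c * |M| * q)
  have hr : IsSimple 𝒜 (fun ω => c * ‖v n ω - v n₀ ω‖ + c * ‖v k ω - v n₀ ω‖) :=
    ((hq n).prodMk h𝒜 (hq k)).comp h𝒜 (fun q => q.1 + q.2)
  have hall : IsSimple 𝒜 (fun ω => (δ + 2 * c * |M| * A.indicator (fun _ => (1 : ℝ)) ω) +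
      (c * ‖v n ω - v n₀ ω‖ + c * ‖v k ω - v n₀ ω‖)) :=
    (hl.prodMk h𝒜 hr).comp h𝒜 (fun q => q.1 + q.2)
  have hle := simpleIntegral_mono (m := m) h𝒜 (hdiff s hsimple n k) hall (by
    intro ω
    have h1 : 0 ≤ c * ‖v n ω - v n₀ ω‖ := by positivity
    have h2 : 0 ≤ c * ‖v k ω - v n₀ ω‖ := by positivity
    by_cases hω : ω ∈ A
    · have e1 := abs_clamp_le hc (u n ω) (v n ω)
      have e2 := abs_clamp_le hc (u k ω) (v k ω)
      have e3 : ‖s n ω - s k ω‖ ≤ |s n ω| + |s k ω| := abs_sub _ _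
      have e4 : ∀ j, |v j ω| ≤ |M| + ‖v j ω - v n₀ ω‖ := fun j => by
        have : |v j ω| ≤ |v n₀ ω| + |v j ω - v n₀ ω| := by
          simpa using abs_add_le (v n₀ ω) (v j ω - v n₀ ω)
        rw [Real.norm_eq_abs]
        linarith [hM ω, le_abs_self M]
      have e5 := mul_le_mul_of_nonneg_left (e4 n) hc
      have e6 := mul_le_mul_of_nonneg_left (e4 k) hc
      rw [indicator_of_mem hω]
      simp only [hs] at e3 ⊢
      linarith
    · rw [indicator_of_notMem hω]
      have : ‖s n ω - s k ω‖ ≤ δ := not_lt.1 hω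
      linarith)
  rw [simpleIntegral_add h𝒜 hl hr, simpleIntegral_add h𝒜 (isSimple_const h𝒜 δ) hA2,
    simpleIntegral_add h𝒜 (hq n) (hq k), simpleIntegral_const,
    simpleIntegral_const_mul h𝒜 hAs, simpleIntegral_indicator_one,
    simpleIntegral_const_mul h𝒜 (hdiff v hv n n₀), simpleIntegral_const_mul h𝒜 (hdiff v hv k n₀)]
    at hle
  have h3 := hn₀ n ((le_max_left _ _).trans hn)
  have h4 := hn₀ k ((le_max_left _ _).trans hk)
  have h5 : 2 * c * |M| * (m A : ℝ) ≤ 2 * c * |M| * (2 * κ) :=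
    mul_le_mul_of_nonneg_left hmA (by positivity)
  linarith

end Simple

end FinAdd

namespace FinAdd

/-! ### Functionals on `ℚ`-subspaces of the dual, and when they are point evaluations. -/

section Duality

variable {E : Type*} [NormedAddCommGroup E] [NormedSpace ℝ E]

theorem exists_submodule_eq_closure (D : AddSubgroup E)
    (hq : ∀ (q : ℚ), ∀ d ∈ D, (q : ℝ) • d ∈ D) :
    ∃ V : Submodule ℝ E, (V : Set E) = closure D := by
  refine ⟨{ D.topologicalClosure with smul_mem' := fun c v hv => ?_ }, rfl⟩
  have h : (c, v) ∈ closure (range ((↑) : ℚ → ℝ) ×ˢ (D : Set E)) := by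
    rw [closure_prod_eq]
    exact ⟨Rat.denseRange_cast c, hv⟩
  refine map_mem_closure (f := fun p : ℝ × E => p.1 • p.2) (by fun_prop) h ?_
  rintro ⟨_, d⟩ ⟨⟨q, rfl⟩, hd⟩
  exact hq q d hd

/-- A bounded `ℚ`-linear functional on a `ℚ`-subspace of a real normed space extends to a bounded
real linear functional. -/
theorem exists_dual_extension (D : AddSubgroup E) (hq : ∀ (q : ℚ), ∀ d ∈ D, (q : ℝ) • d ∈ D)
    (L : E → ℝ) (hadd : ∀ d ∈ D, ∀ e ∈ D, L (d + e) = L d + L e)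
    (hsmul : ∀ (q : ℚ), ∀ d ∈ D, L ((q : ℝ) • d) = q * L d) (M : ℝ≥0)
    (hM : ∀ d ∈ D, |L d| ≤ M * ‖d‖) :
    ∃ G : StrongDual ℝ E, ∀ d ∈ D, G d = L d := by
  have hneg : ∀ d ∈ D, L (-d) = -L d := fun d hd => by simpa using hsmul (-1) d hd
  have hlip : LipschitzOnWith M L D := LipschitzOnWith.of_dist_le_mul fun d hd e he => by
    rw [Real.dist_eq, dist_eq_norm, sub_eq_add_neg, ← hneg e he, ← hadd d hd _ (D.neg_mem he),
      ← sub_eq_add_neg]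
    exact hM _ (D.sub_mem hd he)
  -- This nonlinear Lipschitz extension is only used on the closure of `D`, where density makes it
  -- real linear; Hahn–Banach then takes over.
  obtain ⟨g, hg, hgL⟩ := hlip.extend_real
  have hgc : Continuous g := hg.continuous
  obtain ⟨V, hV⟩ := exists_submodule_eq_closure D hq
  have hV' : ∀ v, v ∈ V ↔ v ∈ closure (D : Set E) := fun v => by rw [← SetLike.mem_coe, hV]
  have hVadd : ∀ v ∈ V, ∀ w ∈ V, g (v + w) = g v + g w := by
    intro v hv w hw
    have h : (v, w) ∈ closure ((D : Set E) ×ˢ (D : Set E)) := by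
      rw [closure_prod_eq]
      exact ⟨(hV' v).1 hv, (hV' w).1 hw⟩
    refine (Set.EqOn.closure (s := (D : Set E) ×ˢ (D : Set E))
      (f := fun p : E × E => g (p.1 + p.2)) (g := fun p : E × E => g p.1 + g p.2) ?_
      (by fun_prop) (by fun_prop)) h
    rintro ⟨d, e⟩ ⟨hd, he⟩
    simp only [← hgL hd, ← hgL he, ← hgL (D.add_mem hd he), hadd d hd e he]
  have hVsmul : ∀ (c : ℝ), ∀ v ∈ V, g (c • v) = c * g v := by
    intro c v hv
    have h : (c, v) ∈ closure (range ((↑) : ℚ → ℝ) ×ˢ (D : Set E)) := by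
      rw [closure_prod_eq]
      exact ⟨Rat.denseRange_cast c, (hV' v).1 hv⟩
    refine (Set.EqOn.closure (s := range ((↑) : ℚ → ℝ) ×ˢ (D : Set E))
      (f := fun p : ℝ × E => g (p.1 • p.2)) (g := fun p : ℝ × E => p.1 * g p.2) ?_
      (by fun_prop) (by fun_prop)) h
    rintro ⟨_, d⟩ ⟨⟨q, rfl⟩, hd⟩
    simp only [← hgL hd, ← hgL (hq q d hd), hsmul q d hd]
  let F : V →ₗ[ℝ] ℝ :=
    { toFun := fun v => g v
      map_add' := fun v w => hVadd v v.2 w w.2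
      map_smul' := fun c v => hVsmul c v v.2 }
  let F' : StrongDual ℝ V := ⟨F, hgc.comp continuous_subtype_val⟩
  obtain ⟨G, hG, -⟩ := exists_extension_norm_eq V F'
  exact ⟨G, fun d hd => (hG ⟨d, (hV' d).2 (subset_closure hd)⟩).trans (hgL hd).symm⟩

theorem exists_forall_eq_sum (V : Submodule ℝ E) {k : ℕ} (ev : Fin k → StrongDual ℝ E)
    (F : StrongDual ℝ E) (h : ∀ v ∈ V, (∀ i, ev i v = 0) → F v = 0) :
    ∃ c : Fin k → ℝ, ∀ v ∈ V, F v = ∑ i, c i * ev i v := by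
  have hspan : F.toLinearMap ∘ₗ V.subtype ∈
      Submodule.span ℝ (range fun i => (ev i).toLinearMap ∘ₗ V.subtype) := by
    refine mem_span_of_iInf_ker_le_ker
      (L := fun i => (ev i).toLinearMap ∘ₗ V.subtype) fun v hv => ?_
    exact h v v.2 fun i => (Submodule.mem_iInf _).1 hv i
  obtain ⟨c, hc⟩ := (Submodule.mem_span_range_iff_exists_fun ℝ).1 hspan
  refine ⟨c, fun v hv => ?_⟩
  have := LinearMap.congr_fun hc ⟨v, hv⟩
  simpa [LinearMap.sum_apply] using this.symm

/-- Every countable set lies in a countable `ℚ`-subspace. -/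
theorem exists_countable_addSubgroup {C : Set E} (hC : C.Countable) :
    ∃ D : AddSubgroup E, (D : Set E).Countable ∧ C ⊆ D ∧
      ∀ (q : ℚ), ∀ d ∈ D, (q : ℝ) • d ∈ D := by
  have : Countable C := hC
  -- The `ℚ`-span is the image of the countable space of finitely supported functions `C →₀ ℚ`.
  let : Module ℚ E := Module.compHom E (algebraMap ℚ ℝ)
  refine ⟨(LinearMap.range (Finsupp.linearCombination ℚ ((↑) : C → E))).toAddSubgroup,
    countable_range _, ?_, ?_⟩
  · rw [Submodule.coe_toAddSubgroup, ← Finsupp.span_eq_range_linearCombination]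
    exact Submodule.subset_span
  · intro q d hd
    exact Submodule.smul_mem _ q hd

variable {X : Type*} [NormedAddCommGroup X] [NormedSpace ℝ X]

/-- The members of `D` in the unit ball that are small at the first terms of the sequence `x`. -/
def smallAt (x : ℕ → X) (D : Set (StrongDual ℝ X)) (k : ℕ) : Set (StrongDual ℝ X) :=
  {d | d ∈ D ∧ ‖d‖ ≤ 1 ∧ ∀ i ≤ k, |d (x i)| ≤ 1 / ((k : ℝ) + 1)}

/-- Let `K` consist of the `v` in `V` that vanish at `x 0, …, x k`. There `|G| ≤ ε ‖v‖`, so the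
restriction of `G` to `K` extends to some `g` of norm at most `ε`. As `G - g` vanishes on `K`, it is
on `V` a combination of finitely many evaluations, hence evaluation at a single point. -/
theorem exists_approx_eval (x : ℕ → X) (D : Set (StrongDual ℝ X))
    (V : Submodule ℝ (StrongDual ℝ X)) (hV : (V : Set (StrongDual ℝ X)) = closure D)
    (G : StrongDual ℝ (StrongDual ℝ X)) {ε : ℝ} (hε : 0 ≤ ε) (k : ℕ)
    (hk : ∀ d ∈ smallAt x D k, |G d| ≤ ε) :
    ∃ y : X, ∀ d ∈ D, |G d - d y| ≤ ε * ‖d‖ := by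
  let ev : Fin (k + 1) → StrongDual ℝ (StrongDual ℝ X) :=
    fun i => NormedSpace.inclusionInDoubleDual ℝ X (x i)
  let K : Submodule ℝ (StrongDual ℝ X) := V ⊓ ⨅ i, LinearMap.ker (ev i).toLinearMap
  have hKev : ∀ v ∈ K, ∀ i ≤ k, v (x i) = 0 := by
    intro v hv i hi
    have := (Submodule.mem_iInf _).1 (Submodule.mem_inf.1 hv).2 ⟨i, Nat.lt_succ_of_le hi⟩
    simpa [ev] using this
  have hball : ∀ v ∈ K, ‖v‖ < 1 → |G v| ≤ ε := by
    intro v hv hv1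
    -- Elements of `K` are only limits of elements of `D`; strict inequalities make `U` open, so
    -- that `v` is a limit of elements of `D ∩ U`, which lie in `smallAt x D k`.
    let U : Set (StrongDual ℝ X) := {d | ‖d‖ < 1} ∩
      ⋂ i ∈ Finset.range (k + 1), {d | |d (x i)| < 1 / ((k : ℝ) + 1)}
    have hU : IsOpen U := by
      refine (isOpen_lt continuous_norm continuous_const).inter
        (isOpen_biInter_finset fun i _ => isOpen_lt ?_ continuous_const)
      exact ((NormedSpace.inclusionInDoubleDual ℝ X (x i)).continuous).abs
    have hvU : v ∈ U := by
      refine ⟨hv1, mem_iInter₂.2 fun i hi => ?_⟩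
      have : v (x i) = 0 := hKev v hv i (Nat.lt_succ_iff.1 (Finset.mem_range.1 hi))
      simp only [mem_ofPred_eq, this, abs_zero]
      positivity
    have hvD : v ∈ closure D := hV ▸ (Submodule.mem_inf.1 hv).1
    refine closure_minimal (t := {d | |G d| ≤ ε}) ?_
      (isClosed_le G.continuous.abs continuous_const) (hU.inter_closure ⟨hvU, hvD⟩)
    rintro d ⟨⟨hd1, hd2⟩, hdD⟩
    exact hk d ⟨hdD, hd1.le, fun i hi =>
      (mem_iInter₂.1 hd2 i (Finset.mem_range.2 (Nat.lt_succ_of_le hi))).le⟩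
  have hKG : ∀ v ∈ K, |G v| ≤ ε * ‖v‖ := by
    intro v hv
    by_contra! hcon
    have hGv : 0 < |G v| := (mul_nonneg hε (norm_nonneg v)).trans_lt hcon
    have hv0 : 0 < ‖v‖ := norm_pos_iff.2 fun h => by simp [h] at hGv
    -- The midpoint of `ε / |G v|` and `1 / ‖v‖`: it gives `‖r • v‖ < 1` and yet `|G (r • v)| > ε`.
    set r : ℝ := (ε * ‖v‖ + |G v|) / (2 * |G v| * ‖v‖) with hr
    have hr0 : 0 ≤ r := by positivity
    have h1 := hball (r • v) (K.smul_mem r hv) (by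
      rw [norm_smul, Real.norm_of_nonneg hr0, hr, div_mul_eq_mul_div, div_lt_one (by positivity)]
      nlinarith)
    rw [map_smul, smul_eq_mul, abs_mul, abs_of_nonneg hr0, hr, div_mul_eq_mul_div,
      div_le_iff₀ (by positivity)] at h1
    nlinarith
  obtain ⟨g, hg, hgn⟩ := exists_extension_norm_eq K (G.comp K.subtypeL)
  have hgε : ‖g‖ ≤ ε := by
    rw [hgn]
    exact ContinuousLinearMap.opNorm_le_bound _ hε fun v => hKG v v.2
  obtain ⟨c, hc⟩ := exists_forall_eq_sum V ev (G - g) fun v hv hev => by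
    have := hg ⟨v, hv, (Submodule.mem_iInf _).2 hev⟩
    exact sub_eq_zero.2 this.symm
  refine ⟨∑ i, c i • x i, fun d hd => ?_⟩
  have hdV : d ∈ V := by
    rw [← SetLike.mem_coe, hV]
    exact subset_closure hd
  have h3 : d (∑ i, c i • x i) = G d - g d := by
    simpa [ev] using (hc d hdV).symm
  rw [h3, sub_sub_cancel]
  exact (g.le_opNorm d).trans (mul_le_mul_of_nonneg_right hgε (norm_nonneg d))

theorem norm_le_of_forall_norming {x : ℕ → X} (hx : DenseRange x) {D : Set (StrongDual ℝ X)}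
    (hD : ∀ k, ∃ d ∈ D, ‖d‖ ≤ 1 ∧ d (x k) = ‖x k‖) {y : X} {M : ℝ}
    (hy : ∀ d ∈ D, ‖d‖ ≤ 1 → |d y| ≤ M) : ‖y‖ ≤ M := by
  refine le_of_forall_pos_le_add fun ε hε => ?_
  obtain ⟨k, hk⟩ := hx.exists_dist_lt y (half_pos hε)
  obtain ⟨d, hdD, hd1, hdk⟩ := hD k
  rw [dist_eq_norm] at hk
  have h1 := hy d hdD hd1
  have h2 : |d (y - x k)| ≤ ‖y - x k‖ := by
    have := d.le_of_opNorm_le hd1 (y - x k)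
    rwa [one_mul] at this
  have h3 : ‖y‖ ≤ ‖y - x k‖ + ‖x k‖ := by simpa using norm_add_le (y - x k) (x k)
  rw [map_sub, abs_le] at h2
  rw [abs_le] at h1
  linarith [h1.1, h1.2, h2.1, h2.2]

/-- A bounded `ℚ`-linear functional on a norming `ℚ`-subspace of the dual of a Banach space, weak*
continuous at `0` on the unit ball, is the evaluation at a point. -/
theorem exists_eq_eval [CompleteSpace X] {x : ℕ → X} (hx : DenseRange x)
    (D : AddSubgroup (StrongDual ℝ X)) (hq : ∀ (q : ℚ), ∀ d ∈ D, (q : ℝ) • d ∈ D)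
    (hD : ∀ k, ∃ d ∈ D, ‖d‖ ≤ 1 ∧ d (x k) = ‖x k‖)
    (L : StrongDual ℝ X → ℝ) (hadd : ∀ d ∈ D, ∀ e ∈ D, L (d + e) = L d + L e)
    (hsmul : ∀ (q : ℚ), ∀ d ∈ D, L ((q : ℝ) • d) = q * L d) (M : ℝ≥0)
    (hM : ∀ d ∈ D, |L d| ≤ M * ‖d‖)
    (hL : ∀ ε : ℝ, 0 < ε → ∃ k, ∀ d ∈ smallAt x D k, -L d ≤ ε) :
    ∃ y, ∀ d ∈ D, L d = d y := by
  obtain ⟨G, hG⟩ := exists_dual_extension D hq L hadd hsmul M hM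
  obtain ⟨V, hV⟩ := exists_submodule_eq_closure D hq
  have happ : ∀ n : ℕ, ∃ y : X, ∀ d ∈ D, |L d - d y| ≤ 1 / ((n : ℝ) + 1) * ‖d‖ := by
    intro n
    obtain ⟨k, hk⟩ := hL (1 / ((n : ℝ) + 1)) (by positivity)
    obtain ⟨y, hy⟩ := exists_approx_eval x D V hV G (ε := 1 / ((n : ℝ) + 1)) (by positivity) k (by
      intro d hd
      have h1 := hk d hd
      -- By symmetry of `smallAt x D k`, the one-sided hypothesis bounds both signs.
      have h2 := hk (-d) ⟨D.neg_mem hd.1, by simpa using hd.2.1, by simpa using hd.2.2⟩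
      rw [← hG _ hd.1] at h1
      rw [← hG _ (D.neg_mem hd.1), map_neg] at h2
      exact abs_le.2 ⟨by linarith, by linarith⟩)
    exact ⟨y, fun d hd => by rw [← hG d hd]; exact hy d hd⟩
  choose y hy using happ
  -- All `y n` nearly agree on the unit ball of `D`, which is norming, so they are close in norm.
  have hyc : CauchySeq y := by
    refine cauchySeq_of_le_tendsto_0 (fun N : ℕ => 2 * (1 / ((N : ℝ) + 1))) ?_ ?_
    · intro n k N hn hk
      rw [dist_eq_norm]
      refine norm_le_of_forall_norming hx hD fun d hd hd1 => ?_
      have hle : ∀ j, N ≤ j → |L d - d (y j)| ≤ 1 / ((N : ℝ) + 1) := fun j hj =>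
        calc |L d - d (y j)| ≤ 1 / ((j : ℝ) + 1) * ‖d‖ := hy j d hd
          _ ≤ 1 / ((j : ℝ) + 1) * 1 := by gcongr
          _ ≤ 1 / ((N : ℝ) + 1) := by
            rw [mul_one]
            exact Nat.one_div_le_one_div hj
      have h1 := abs_le.1 (hle n hn)
      have h2 := abs_le.1 (hle k hk)
      rw [map_sub, abs_le]
      constructor <;> linarith [h1.1, h1.2, h2.1, h2.2]
    · simpa using (tendsto_one_div_add_atTop_nhds_zero_nat (𝕜 := ℝ)).const_mul 2
  obtain ⟨z, hz⟩ := cauchySeq_tendsto_of_complete hyc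
  refine ⟨z, fun d hd => ?_⟩
  have h1 : Tendsto (fun n => |L d - d (y n)|) atTop (𝓝 |L d - d z|) :=
    (tendsto_const_nhds.sub ((d.continuous.tendsto z).comp hz)).abs
  have h2 : Tendsto (fun n : ℕ => 1 / ((n : ℝ) + 1) * ‖d‖) atTop (𝓝 0) := by
    simpa using (tendsto_one_div_add_atTop_nhds_zero_nat (𝕜 := ℝ)).mul_const ‖d‖
  have h3 := le_of_tendsto_of_tendsto' h1 h2 fun n => hy n d hd
  exact sub_eq_zero.1 (abs_nonpos_iff.1 h3)

end Duality

end FinAdd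

namespace FinAdd

/-! ### Weak* oscillation, its maximization over countable sets, and the splitting. -/

section Selection

open scoped ENNReal

variable {X : Type*} [NormedAddCommGroup X] [NormedSpace ℝ X]

theorem mem_weakStarSeq_iff {x' : StrongDual ℝ X} {σ : ℕ → StrongDual ℝ X} :
    σ ∈ weakStarSeq x' ↔ (∃ C : ℝ, ∀ n, ‖σ n‖ ≤ C) ∧
      ∀ y, Tendsto (fun n => σ n y) atTop (𝓝 (x' y)) :=
  and_congr_right fun _ => tendsto_iff_forall_eval_tendsto_topDualPairing

/-- On bounded sets, convergence on a dense sequence of points is already weak* convergence. -/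
theorem mem_weakStarSeq_zero {x : ℕ → X} (hx : DenseRange x) {D : Set (StrongDual ℝ X)}
    {σ : ℕ → StrongDual ℝ X} (hσ : ∀ n, σ n ∈ smallAt x D n) : σ ∈ weakStarSeq 0 := by
  refine mem_weakStarSeq_iff.2 ⟨⟨1, fun n => (hσ n).2.1⟩, fun y => ?_⟩
  rw [zero_apply, Metric.tendsto_atTop]
  intro ε hε
  obtain ⟨k, hk⟩ := hx.exists_dist_lt y (half_pos hε)
  obtain ⟨n₀, hn₀⟩ := exists_nat_one_div_lt (half_pos hε)
  refine ⟨max k n₀, fun n hn => ?_⟩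
  have h1 : |σ n (y - x k)| ≤ ‖y - x k‖ := by
    have := (σ n).le_of_opNorm_le (hσ n).2.1 (y - x k)
    rwa [one_mul] at this
  have h2 := (hσ n).2.2 k ((le_max_left _ _).trans hn)
  have h3 : 1 / ((n : ℝ) + 1) ≤ 1 / ((n₀ : ℝ) + 1) :=
    Nat.one_div_le_one_div ((le_max_right _ _).trans hn)
  rw [dist_eq_norm] at hk
  rw [Real.dist_0_eq_abs]
  rw [map_sub] at h1
  have h4 : |σ n y| ≤ |σ n y - σ n (x k)| + |σ n (x k)| := by
    simpa using abs_add_le (σ n y - σ n (x k)) (σ n (x k))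
  linarith

variable {S : Type*}

/-- The weak* oscillation at `0`, over the members of `D` in the unit ball, of the functional
`d ↦ φ d s`. -/
noncomputable def oscAt (x : ℕ → X) (φ : StrongDual ℝ X → S → ℝ) (D : Set (StrongDual ℝ X))
    (s : S) : ℝ≥0∞ :=
  ⨅ k, ⨆ d ∈ smallAt x D k, ENNReal.ofReal (-φ d s)

theorem oscAt_mono (x : ℕ → X) (φ : StrongDual ℝ X → S → ℝ) {D D' : Set (StrongDual ℝ X)}
    (h : D ⊆ D') (s : S) : oscAt x φ D s ≤ oscAt x φ D' s :=
  iInf_mono fun _ => biSup_mono fun _ hd => ⟨h hd.1, hd.2⟩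

theorem oscAt_le {x : ℕ → X} {φ : StrongDual ℝ X → S → ℝ} {D : Set (StrongDual ℝ X)} {s : S}
    {M : ℝ} (hM : 0 ≤ M) (h : ∀ d ∈ D, |φ d s| ≤ ‖d‖ * M) : oscAt x φ D s ≤ ENNReal.ofReal M := by
  refine (iInf_le _ 0).trans (iSup₂_le fun d hd => ENNReal.ofReal_le_ofReal ?_)
  nlinarith [h d hd.1, neg_abs_le (φ d s), hd.2.1]

theorem exists_lt_neg_of_oscAt {x : ℕ → X} {φ : StrongDual ℝ X → S → ℝ}
    {D : Set (StrongDual ℝ X)} {s : S} (hpos : 0 < (oscAt x φ D s).toReal) {ε : ℝ} (hε : 0 < ε)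
    (k : ℕ) : ∃ d ∈ smallAt x D k, φ d s ≤ -(oscAt x φ D s).toReal + ε := by
  by_contra! hcon
  -- Since `toReal` sends `∞` to `0`, positivity also excludes an infinite oscillation.
  obtain ⟨h0, htop⟩ := ENNReal.toReal_pos_iff.1 hpos
  have h1 : oscAt x φ D s ≤ ENNReal.ofReal ((oscAt x φ D s).toReal - ε) :=
    (iInf_le _ k).trans (iSup₂_le fun d hd => ENNReal.ofReal_le_ofReal (by linarith [hcon d hd]))
  have h2 : ENNReal.ofReal ((oscAt x φ D s).toReal - ε) <
      ENNReal.ofReal (oscAt x φ D s).toReal :=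
    (ENNReal.ofReal_lt_ofReal_iff hpos).2 (by linarith)
  rw [ENNReal.ofReal_toReal htop.ne] at h2
  exact (h1.trans_lt h2).false

theorem exists_forall_smallAt_of_oscAt_eq_zero {x : ℕ → X} {φ : StrongDual ℝ X → S → ℝ}
    {D : Set (StrongDual ℝ X)} {s : S} (h : oscAt x φ D s = 0) {ε : ℝ} (hε : 0 < ε) :
    ∃ k, ∀ d ∈ smallAt x D k, -φ d s ≤ ε := by
  have h1 : oscAt x φ D s < ENNReal.ofReal ε := by
    rw [h]
    exact ENNReal.ofReal_pos.2 hε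
  obtain ⟨k, hk⟩ := iInf_lt_iff.1 h1
  refine ⟨k, fun d hd => (ENNReal.ofReal_le_ofReal_iff hε.le).1 ?_⟩
  exact (le_iSup₂ (f := fun d (_ : d ∈ smallAt x D k) => ENNReal.ofReal (-φ d s)) d hd).trans hk.le

variable [MeasurableSpace S]

theorem measurable_oscAt (x : ℕ → X) {φ : StrongDual ℝ X → S → ℝ} (hφ : ∀ d, Measurable (φ d))
    {D : Set (StrongDual ℝ X)} (hD : D.Countable) : Measurable (oscAt x φ D) :=
  Measurable.iInf fun _ => Measurable.biSup _ (hD.mono fun _ h => h.1)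
    fun d _ => (hφ d).neg.ennreal_ofReal

variable {lam : Measure S}

/-- An exhaustion argument: the union of a maximizing sequence of countable sets is countable, and
the oscillation is monotone in the set. -/
theorem exists_maximal_oscAt (x : ℕ → X) (φ : StrongDual ℝ X → S → ℝ) :
    ∃ C : Set (StrongDual ℝ X), C.Countable ∧ ∀ D : Set (StrongDual ℝ X), D.Countable →
      ∫⁻ s, oscAt x φ D s ∂lam ≤ ∫⁻ s, oscAt x φ C s ∂lam := by
  obtain ⟨u, -, hu, hmem⟩ := exists_seq_tendsto_sSup
    (S := (fun D : Set (StrongDual ℝ X) => ∫⁻ s, oscAt x φ D s ∂lam) '' {D | D.Countable})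
    ⟨_, ∅, countable_empty, rfl⟩ (OrderTop.bddAbove _)
  choose C hC hCu using hmem
  refine ⟨⋃ n, C n, countable_iUnion hC, fun D hD => ?_⟩
  have hle := le_sSup (a := ∫⁻ s, oscAt x φ D s ∂lam)
    (s := (fun D : Set (StrongDual ℝ X) => ∫⁻ s, oscAt x φ D s ∂lam) '' {D | D.Countable})
    ⟨D, hD, rfl⟩
  refine hle.trans (le_of_tendsto' hu fun n => ?_)
  rw [← hCu n]
  exact lintegral_mono fun s => oscAt_mono x φ (subset_iUnion C n) s

/-- Countability of `D` and of `ℚ` lets all the linear relations and bounds hold off one null set,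
so that the duality criterion applies for each remaining `s`. -/
theorem ae_exists_eq_eval [CompleteSpace X] {x : ℕ → X} (hx : DenseRange x)
    {φ : StrongDual ℝ X → S → ℝ}
    (hadd : ∀ d e, φ (d + e) =ᵐ[lam] fun s => φ d s + φ e s)
    (hsmul : ∀ (c : ℝ) d, φ (c • d) =ᵐ[lam] fun s => c * φ d s)
    {N : S → ℝ} (hb : ∀ d, ∀ᵐ s ∂lam, |φ d s| ≤ ‖d‖ * N s)
    (D : AddSubgroup (StrongDual ℝ X)) (hDc : (D : Set (StrongDual ℝ X)).Countable)
    (hq : ∀ (q : ℚ), ∀ d ∈ D, (q : ℝ) • d ∈ D)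
    (hD : ∀ k, ∃ d ∈ D, ‖d‖ ≤ 1 ∧ d (x k) = ‖x k‖) :
    ∀ᵐ s ∂lam, oscAt x φ D s = 0 → ∃ y, ‖y‖ ≤ |N s| ∧ ∀ d ∈ D, φ d s = d y := by
  have h1 : ∀ᵐ s ∂lam, ∀ d ∈ D, ∀ e ∈ D, φ (d + e) s = φ d s + φ e s :=
    (ae_ball_iff hDc).2 fun d _ => (ae_ball_iff hDc).2 fun e _ => hadd d e
  have h2 : ∀ᵐ s ∂lam, ∀ q : ℚ, ∀ d ∈ D, φ ((q : ℝ) • d) s = q * φ d s :=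
    ae_all_iff.2 fun q => (ae_ball_iff hDc).2 fun d _ => hsmul q d
  have h3 : ∀ᵐ s ∂lam, ∀ d ∈ D, |φ d s| ≤ ‖d‖ * N s := (ae_ball_iff hDc).2 fun d _ => hb d
  filter_upwards [h1, h2, h3] with s h1 h2 h3 h0
  have h4 : ∀ d ∈ D, |φ d s| ≤ |N s| * ‖d‖ := fun d hd => (h3 d hd).trans (by
    rw [mul_comm]
    gcongr
    exact le_abs_self _)
  obtain ⟨y, hy⟩ := exists_eq_eval hx D hq hD (fun d => φ d s) h1 h2 ‖N s‖₊ h4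
    fun ε hε => exists_forall_smallAt_of_oscAt_eq_zero h0 hε
  refine ⟨y, norm_le_of_forall_norming hx hD fun d hd hd1 => ?_, hy⟩
  rw [← hy d hd]
  exact (h4 d hd).trans (mul_le_of_le_one_right (abs_nonneg _) hd1)

/-- A continuous injection of the Polish space `X` into `ℝ^D` is a Borel embedding (Lusin–Souslin),
so measurability can be tested coordinatewise. -/
theorem aestronglyMeasurable_of_separating [CompleteSpace X]
    [TopologicalSpace.SeparableSpace X] {D : Set (StrongDual ℝ X)} (hDc : D.Countable)
    (hsep : ∀ y y' : X, (∀ d ∈ D, d y = d y') → y = y') {g : S → X}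
    (hg : ∀ d ∈ D, AEMeasurable (fun s => d (g s)) lam) : AEStronglyMeasurable g lam := by
  have : Countable D := hDc
  let : MeasurableSpace X := borel X
  have : BorelSpace X := ⟨rfl⟩
  have : SecondCountableTopology X := UniformSpace.secondCountable_of_separable X
  have he : MeasurableEmbedding (fun y : X => fun d : D => d.1 y) :=
    Continuous.measurableEmbedding (by fun_prop) fun y y' h =>
      hsep y y' fun d hd => congrFun h ⟨d, hd⟩
  have : AEMeasurable g lam := he.aemeasurable_comp_iff.1 (aemeasurable_pi_iff.2 fun d => hg d d.2)
  exact this.aestronglyMeasurable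

/-- Splitting of a dominated linear family of integrable functions indexed by the dual of a
separable Banach space: outside `{η > 0}` it is evaluation at an integrable `g`, and on `{η > 0}`
it jumps down by at least `η` along weak* null sequences taken from a fixed countable set. -/
theorem exists_splitting [CompleteSpace X] [TopologicalSpace.SeparableSpace X]
    {φ : StrongDual ℝ X → S → ℝ} (hφ : ∀ d, Measurable (φ d))
    (hadd : ∀ d e, φ (d + e) =ᵐ[lam] fun s => φ d s + φ e s)
    (hsmul : ∀ (c : ℝ) d, φ (c • d) =ᵐ[lam] fun s => c * φ d s)
    {N : S → ℝ} (hN : Integrable N lam) (hb : ∀ d, ∀ᵐ s ∂lam, |φ d s| ≤ ‖d‖ * N s) :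
    ∃ (η : S → ℝ) (g : S → X), Integrable η lam ∧ (∀ s, 0 ≤ η s) ∧ Integrable g lam ∧
      (∀ s, 0 < η s → g s = 0) ∧ (∀ d, ∀ᵐ s ∂lam, η s = 0 → φ d s = d (g s)) ∧
      ∃ D : Set (StrongDual ℝ X), D.Countable ∧ ∀ s, 0 < η s → ∃ σ ∈ weakStarSeq 0,
        ∀ n, σ n ∈ D ∧ φ (σ n) s ≤ -η s + 1 / ((n : ℝ) + 1) := by
  classical
  let x : ℕ → X := TopologicalSpace.denseSeq X
  have hx : DenseRange x := TopologicalSpace.denseRange_denseSeq X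
  choose d₀ hd₀ hd₀x using fun k => exists_dual_vector'' ℝ (x k)
  obtain ⟨C, hC, hCmax⟩ := exists_maximal_oscAt (lam := lam) x φ
  obtain ⟨D, hDc, hCD, hDq⟩ := exists_countable_addSubgroup (hC.union (countable_range d₀))
  have hDn : ∀ k, ∃ d ∈ D, ‖d‖ ≤ 1 ∧ d (x k) = ‖x k‖ := fun k =>
    ⟨d₀ k, hCD (Or.inr ⟨k, rfl⟩), hd₀ k, hd₀x k⟩
  have hDmax : ∀ D' : Set (StrongDual ℝ X), D'.Countable →
      ∫⁻ s, oscAt x φ D' s ∂lam ≤ ∫⁻ s, oscAt x φ D s ∂lam := fun D' hD' =>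
    (hCmax D' hD').trans (lintegral_mono fun s => oscAt_mono x φ (subset_union_left.trans hCD) s)
  have hsep : ∀ y y' : X, (∀ d ∈ (D : Set (StrongDual ℝ X)), d y = d y') → y = y' := by
    intro y y' h
    refine sub_eq_zero.1 (norm_le_zero_iff.1 (norm_le_of_forall_norming hx hDn fun d hd _ => ?_))
    simp [h d hd]
  have hmeas := measurable_oscAt x hφ hDc
  have hfin : ∫⁻ s, oscAt x φ D s ∂lam ≠ ∞ := by
    have h3 : ∀ᵐ s ∂lam, ∀ d ∈ D, |φ d s| ≤ ‖d‖ * N s := (ae_ball_iff hDc).2 fun d _ => hb d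
    refine ne_top_of_le_ne_top hN.abs.lintegral_lt_top.ne (lintegral_mono_ae ?_)
    filter_upwards [h3] with s h3
    exact oscAt_le (abs_nonneg _) fun d hd => (h3 d hd).trans
      (mul_le_mul_of_nonneg_left (le_abs_self _) (norm_nonneg d))
  have hrep := ae_exists_eq_eval hx hadd hsmul hb D hDc hDq hDn
  let R : S → Prop := fun s => oscAt x φ D s = 0 ∧ ∃ y, ‖y‖ ≤ |N s| ∧ ∀ d ∈ D, φ d s = d y
  -- The arbitrary choice is harmless: `D` separates points, so the point is unique, and
  -- measurability is recovered from the functions `d (g s)` with `d ∈ D`.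
  let g : S → X := fun s => if h : R s then h.2.choose else 0
  have hgR : ∀ s, R s → ‖g s‖ ≤ |N s| ∧ ∀ d ∈ D, φ d s = d (g s) := fun s h => by
    simp only [g, dif_pos h]
    exact h.2.choose_spec
  have hg0 : ∀ s, oscAt x φ D s ≠ 0 → g s = 0 := fun s h => dif_neg fun hR => h hR.1
  have hgN : ∀ s, ‖g s‖ ≤ ‖N s‖ := fun s => by
    by_cases h : R s
    · exact (hgR s h).1
    · simp [g, dif_neg h]
  have hgm : AEStronglyMeasurable g lam := by
    refine aestronglyMeasurable_of_separating hDc hsep fun d hd => ?_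
    refine ((hφ d).indicator (hmeas (measurableSet_singleton 0))).aemeasurable.congr ?_
    filter_upwards [hrep] with s hs
    by_cases h : oscAt x φ D s = 0
    · rw [indicator_of_mem (by exact h)]
      exact (hgR s ⟨h, hs h⟩).2 d hd
    · rw [indicator_of_notMem (by exact h), hg0 s h, map_zero]
  refine ⟨fun s => (oscAt x φ D s).toReal, g,
    integrable_toReal_of_lintegral_ne_top hmeas.aemeasurable hfin,
    fun s => ENNReal.toReal_nonneg, hN.mono hgm (ae_of_all _ hgN),
    fun s hs => hg0 s (ENNReal.toReal_pos_iff.1 hs).1.ne', fun d => ?_, D, hDc, fun s hs => ?_⟩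
  -- Maximality together with the finite integral gives equal oscillations for `D` and `D'` a.e.;
  -- the point that represents `φ` on `D'` must then be `g s`.
  · obtain ⟨D', hD'c, hDD', hD'q⟩ := exists_countable_addSubgroup (hDc.insert d)
    have hsub : (D : Set (StrongDual ℝ X)) ⊆ D' := (subset_insert _ _).trans hDD'
    have heq : oscAt x φ D =ᵐ[lam] oscAt x φ D' :=
      ae_eq_of_ae_le_of_lintegral_le (ae_of_all _ fun s => oscAt_mono x φ hsub s) hfin
        (measurable_oscAt x hφ hD'c).aemeasurable (hDmax D' hD'c)
    have hrep' := ae_exists_eq_eval hx hadd hsmul hb D' hD'c hD'q fun k =>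
      (hDn k).imp fun d hd => ⟨hsub hd.1, hd.2⟩
    filter_upwards [heq, hrep', ae_lt_top hmeas hfin] with s hs hs' hlt h0
    have h0' : oscAt x φ D s = 0 :=
      ((ENNReal.toReal_eq_zero_iff _).1 h0).resolve_right hlt.ne
    obtain ⟨y, hyN, hy⟩ := hs' (hs ▸ h0')
    have hR : R s := ⟨h0', y, hyN, fun e he => hy e (hsub he)⟩
    have : g s = y := hsep _ _ fun e he => by rw [← (hgR s hR).2 e he, hy e (hsub he)]
    rw [this]
    exact hy d (hDD' (mem_insert _ _))
  · choose σ hσ hσ' using fun n : ℕ =>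
      exists_lt_neg_of_oscAt hs (Nat.one_div_pos_of_nat (α := ℝ) (n := n)) n
    exact ⟨σ, mem_weakStarSeq_zero hx hσ, fun n => ⟨(hσ n).1, hσ' n⟩⟩

end Selection

end FinAdd

/-! ### The functionals induced by `T`, and the theorem. -/

namespace FinAdd

theorem IsAbstractStandardRepresentation.mono {Ω X S : Type*} {𝒜 : Set (Set Ω)}
    {m : AddContent ℝ≥0 𝒜} {f : Ω → X} [TopologicalSpace S] [MeasurableSpace S]
    {χ : Set Ω → Set S} {lam : Measure S} {T : (Ω × X → ℝ) → Lp ℝ 1 lam}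
    (hT : IsAbstractStandardRepresentation m f χ lam T)
    {H K : Ω × X → ℝ} (hH : H ∈ Lspace m f) (hK : K ∈ Lspace m f) (h : H ≤ K) : T H ≤ T K := by
  have := hT.T_sup H hH K hK
  rw [sup_eq_right.2 h] at this
  rw [this]
  exact le_sup_left

section Functionals

variable {Ω : Type*} {𝒜 : Set (Set Ω)} {m : AddContent ℝ≥0 𝒜} {X : Type*} {f : Ω → X}
  [NormedAddCommGroup X] [NormedSpace ℝ X]

theorem lift_dual_mem_Lspace (h𝒜 : IsSetAlgebra 𝒜) (hfw : WeaklyMeasurable m f)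
    (hfn : NormIntegrable m f) (x' : StrongDual ℝ X) : lift Ω (fun x => x' x) ∈ Lspace m f :=
  (hfw x').memL1_of_abs_le h𝒜 (norm_nonneg x') hfn fun ω => by
    rw [abs_norm]
    exact x'.le_opNorm (f ω)

variable {S : Type*} [TopologicalSpace S] [MeasurableSpace S] {χ : Set Ω → Set S}
  {lam : Measure S} {T : (Ω × X → ℝ) → Lp ℝ 1 lam}

theorem IsAbstractStandardRepresentation.map_dual_smul (h𝒜 : IsSetAlgebra 𝒜)
    (hfw : WeaklyMeasurable m f) (hfn : NormIntegrable m f)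
    (hT : IsAbstractStandardRepresentation m f χ lam T) (c : ℝ) (d : StrongDual ℝ X) :
    T (lift Ω fun x => (c • d) x) =ᵐ[lam] fun s => c * T (lift Ω fun x => d x) s := by
  rw [show (lift Ω fun x => (c • d) x) = c • lift Ω fun x => d x from rfl,
    hT.T_smul c _ (lift_dual_mem_Lspace h𝒜 hfw hfn d)]
  exact Lp.coeFn_smul _ _

theorem IsAbstractStandardRepresentation.map_dual_add (h𝒜 : IsSetAlgebra 𝒜)
    (hfw : WeaklyMeasurable m f) (hfn : NormIntegrable m f)
    (hT : IsAbstractStandardRepresentation m f χ lam T) (d e : StrongDual ℝ X) :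
    T (lift Ω fun x => (d + e) x) =ᵐ[lam]
      fun s => T (lift Ω fun x => d x) s + T (lift Ω fun x => e x) s := by
  rw [show (lift Ω fun x => (d + e) x) = (lift Ω fun x => d x) + lift Ω fun x => e x from rfl,
    hT.T_add _ (lift_dual_mem_Lspace h𝒜 hfw hfn d) _ (lift_dual_mem_Lspace h𝒜 hfw hfn e)]
  exact Lp.coeFn_add _ _

/-- Monotonicity of `T` is applied to both signs of the normalized functional, which lie below the
norm. For `d = 0` the convention `0⁻¹ = 0` keeps the normalization valid. -/
theorem IsAbstractStandardRepresentation.ae_abs_map_dual_le (h𝒜 : IsSetAlgebra 𝒜)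
    (hfw : WeaklyMeasurable m f) (hfn : NormIntegrable m f)
    (hT : IsAbstractStandardRepresentation m f χ lam T) (d : StrongDual ℝ X) :
    ∀ᵐ s ∂lam, |T (lift Ω fun x => d x) s| ≤ ‖d‖ * T (lift Ω fun x => ‖x‖) s := by
  have hmem := lift_dual_mem_Lspace h𝒜 hfw hfn
  have hunit : ∀ u : StrongDual ℝ X, ‖u‖ ≤ 1 →
      T (lift Ω fun x => u x) ≤ᵐ[lam] T (lift Ω fun x => ‖x‖) := fun u hu =>
    Lp.coeFn_le _ _ |>.2 <| hT.mono (hmem u) hfn fun p =>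
      (le_abs_self _).trans ((u.le_of_opNorm_le hu p.2).trans_eq (one_mul _))
  have hu : ‖‖d‖⁻¹ • d‖ ≤ 1 := by
    rw [norm_smul, norm_inv, norm_norm]
    exact inv_mul_le_one
  have hd : d = ‖d‖ • ‖d‖⁻¹ • d := by
    by_cases h : d = 0
    · simp [h]
    · rw [smul_inv_smul₀ (norm_ne_zero_iff.2 h)]
  have h3 := hT.map_dual_smul h𝒜 hfw hfn ‖d‖ (‖d‖⁻¹ • d)
  rw [← hd] at h3
  filter_upwards [hunit _ hu, hunit ((-1 : ℝ) • ‖d‖⁻¹ • d) (by rwa [norm_smul, norm_neg, norm_one, one_mul]), h3,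
    hT.map_dual_smul h𝒜 hfw hfn (-1) (‖d‖⁻¹ • d)] with s h1 h2 h3 h4
  rw [h3, abs_mul, abs_norm]
  refine mul_le_mul_of_nonneg_left (abs_le.2 ⟨by linarith, h1⟩) (norm_nonneg d)

end Functionals

theorem limsup_coe_add_le {a η : ℝ} {u : ℕ → ℝ} (hu : ∀ n, u n ≤ a + (-η + 1 / ((n : ℝ) + 1))) :
    (η : EReal) + limsup (fun n => (u n : EReal)) atTop ≤ (a : EReal) := by
  have hlim : Tendsto (fun n : ℕ => a + (-η + 1 / ((n : ℝ) + 1))) atTop (𝓝 (a - η)) := by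
    have := ((tendsto_one_div_add_atTop_nhds_zero_nat (𝕜 := ℝ)).const_add (-η)).const_add a
    rwa [add_zero, ← sub_eq_add_neg] at this
  have h1 : limsup (fun n => (u n : EReal)) atTop ≤ ((a - η : ℝ) : EReal) := by
    rw [← ((continuous_coe_real_ereal.tendsto _).comp hlim).limsup_eq]
    exact limsup_le_limsup (Eventually.of_forall fun n => EReal.coe_le_coe_iff.2 (hu n))
  calc (η : EReal) + limsup (fun n => (u n : EReal)) atTop
      ≤ (η : EReal) + ((a - η : ℝ) : EReal) := by gcongr
    _ = (a : EReal) := by rw [← EReal.coe_add, add_sub_cancel]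

end FinAdd

theorem theorem7p1 {Ω : Type*} {𝒜 : Set (Set Ω)} (h𝒜 : MeasureTheory.IsSetAlgebra 𝒜)
    (m : MeasureTheory.AddContent ℝ≥0 𝒜) (hm : m Set.univ = 1)
    {X : Type*} [NormedAddCommGroup X] [NormedSpace ℝ X] [CompleteSpace X]
    [TopologicalSpace.SeparableSpace X]
    (f : Ω → X) (hfw : FinAdd.WeaklyMeasurable m f) (hfn : FinAdd.NormIntegrable m f)
    {S : Type*} [TopologicalSpace S] [MeasurableSpace S]
    (χ : Set Ω → Set S) (lam : MeasureTheory.Measure S)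
    (T : (Ω × X → ℝ) → MeasureTheory.Lp ℝ 1 lam)
    (hT : FinAdd.IsAbstractStandardRepresentation m f χ lam T) :
    ∃ (η : S → ℝ) (f' : S → X),
      MeasureTheory.Integrable η lam ∧ (∀ s, 0 ≤ η s) ∧
      MeasureTheory.Integrable f' lam ∧ (∀ s, 0 < η s → f' s = 0) ∧
      -- `T = (f' evaluation) + T^⊥`, and the rest holds for all choices of representatives
      (∃ P : (X → ℝ) → S → ℝ, FinAdd.IsRemainder m f T f' P) ∧
      ∀ P : (X → ℝ) → S → ℝ, FinAdd.IsRemainder m f T f' P →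
        ∀ x' : StrongDual ℝ X,
          (∀ᵐ s ∂lam, η s = 0 → P (fun x => x' x) s = 0) ∧
          ∀ᵐ s ∂lam,
            (η s : EReal) + ⨅ σ ∈ FinAdd.weakStarSeq x',
                Filter.limsup (fun n => ((P (fun x => σ n x) s : ℝ) : EReal)) Filter.atTop
              ≤ ((P (fun x => x' x) s : ℝ) : EReal) := by
  let φ : StrongDual ℝ X → S → ℝ := fun d => T (FinAdd.lift Ω fun x => d x)
  have hmem := FinAdd.lift_dual_mem_Lspace h𝒜 hfw hfn
  obtain ⟨η, g, hη, hη0, hg, hηg, hφg, D, hDc, hD⟩ := FinAdd.exists_splitting (lam := lam) (φ := φ)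
    (fun d => (Lp.stronglyMeasurable _).measurable) (hT.map_dual_add h𝒜 hfw hfn)
    (hT.map_dual_smul h𝒜 hfw hfn) (L1.integrable_coeFn (T (FinAdd.lift Ω fun x => ‖x‖)))
    (hT.ae_abs_map_dual_le h𝒜 hfw hfn)
  refine ⟨η, g, hη, hη0, hg, hηg,
    ⟨fun h s => T (FinAdd.lift Ω h) s - h (g s), fun h _ => ae_of_all _ fun s => by simp⟩,
    fun P hP x' => ⟨?_, ?_⟩⟩
  · filter_upwards [hφg x', hP _ (hmem x')] with s h1 h2 h0
    have h1 : T (FinAdd.lift Ω fun x => x' x) s = x' (g s) := h1 h0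
    linarith
  -- The infimum runs over uncountably many sequences, but an upper bound needs only one, with terms
  -- in the countable set `x' + D`. Representatives outside `x'` and `x' + D` play no role.
  · filter_upwards [hP _ (hmem x'), (ae_ball_iff hDc).2 fun d _ => hP _ (hmem (x' + d)),
      (ae_ball_iff hDc).2 fun d _ => hT.map_dual_add h𝒜 hfw hfn x' d] with s h1 h2 h3
    rcases (hη0 s).eq_or_lt with h0 | h0
    · rw [← h0, EReal.coe_zero, zero_add]
      exact (iInf₂_le (fun _ => x') (FinAdd.mem_weakStarSeq_iff.2
        ⟨⟨‖x'‖, fun _ => le_rfl⟩, fun _ => tendsto_const_nhds⟩)).trans_eq (limsup_const _)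
    · obtain ⟨σ, hσ, hσD⟩ := hD s h0
      obtain ⟨⟨C, hC⟩, hσ0⟩ := FinAdd.mem_weakStarSeq_iff.1 hσ
      have hσ' : (fun n => x' + σ n) ∈ FinAdd.weakStarSeq x' := FinAdd.mem_weakStarSeq_iff.2
        ⟨⟨‖x'‖ + C, fun n => (norm_add_le _ _).trans (by gcongr; exact hC n)⟩,
          fun y => by simpa using (hσ0 y).const_add (x' y)⟩
      refine (add_le_add_right (iInf₂_le _ hσ') _).trans (FinAdd.limsup_coe_add_le fun n => ?_)
      have e2 := h2 _ (hσD n).1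
      have e3 := h3 _ (hσD n).1
      have e4 := (hσD n).2
      -- Here `g s = 0`, so the remainder coincides with `φ` at `x'` and at `x' + σ n`.
      simp only [hηg s h0, map_zero, zero_add] at h1 e2
      simp only [φ] at e4
      rw [← e2, e3, ← h1]
      linarith
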